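/- Let $m\ge 2$ be an integer, let $A,B\in\mathbb{Z}$, and let $$F(x)=x^m+Ax^{m-1}+B\in\mathbb{Z}[x],\qquad D=m^mB-(-1)^m(m-1)^{m-1}A^m .$$ Suppose that $B$ and $D$ are squarefree, that $|B|\ge 2$, and that $F(x)$ is irreducible over $\mathbb{Q}$. Then $F(x)$ is monogenic; that is, $F(x)$ is irreducible over $\mathbb{Q}$ and, for every $\theta\in\mathbb{C}$ with $F(\theta)=0$, the ring of integers of $K=\mathbb{Q}(\theta)$ is $\mathbb{Z}_K=\mathbb{Z}[\theta]$. -/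

import Mathlib

open Polynomial

noncomputable section

/-- An integer polynomial `f` is monogenic if it is irreducible over `ℚ` and, for every complex root
`θ` of `f`, the ring of integers of `K = ℚ(θ)` (the integral closure of `ℤ` in `K`) is the subring
`ℤ[θ]` of `K`. -/
def IsMonogenicPoly (f : ℤ[X]) : Prop :=
  Irreducible (f.map (Int.castRingHom ℚ)) ∧
    ∀ θ : ℂ, aeval θ f = 0 →
      integralClosure ℤ (IntermediateField.adjoin ℚ {θ}) =
        Algebra.adjoin ℤ {IntermediateField.AdjoinSimple.gen ℚ θ}

/-- The trinomial `x ^ m + A x ^ (m - 1) + B`. -/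
def trinomialF (m : ℕ) (A B : ℤ) : ℤ[X] :=
  X ^ m + C A * X ^ (m - 1) + C B

/-- The integer `m ^ m B - (-1) ^ m (m - 1) ^ (m - 1) A ^ m`. -/
def trinomialD (m : ℕ) (A B : ℤ) : ℤ :=
  (m : ℤ) ^ m * B - (-1) ^ m * ((m : ℤ) - 1) ^ (m - 1) * A ^ m

end

/-! A Noetherian domain whose localizations at nonzero primes are DVRs is integrally closed, so
`ℤ[θ]` is checked prime by prime. For `P` above `p`, write `P = (g(θ), p)` and `F = g h + p k`. If
`h(θ) ∉ P`, then `p` generates `P` locally. Otherwise `F'(θ) ∈ P`, and the factorization of `F'`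
puts `θ` or `m θ + (m - 1) A` in `P`. Hence `θ - r ∈ P` for an integer `r` that is `0` or a root of
`m x + (m - 1) A` mod `p ^ 2`. Since `F(0) = B` and `m ^ m F(r) ≡ D`, squarefreeness gives `p ^ 2 ∤
F(r)`, and `θ - r` generates `P` locally. -/

/-- For an ideal `P` of `R`, an element `θ : R` and a prime `p`, there is a polynomial `g` with
`g(θ) ∈ P` such that every integer polynomial whose value at `θ` lies in `P` is a
combination of `g` and `p`. -/
theorem exists_generator_of_comap_aeval {R : Type*} [CommRing R] (θ : R) (P : Ideal R) (p : ℕ)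
    [Fact p.Prime] :
    ∃ g : ℤ[X], aeval θ g ∈ P ∧
      ∀ f : ℤ[X], aeval θ f ∈ P → ∃ q s : ℤ[X], f = g * q + C (p : ℤ) * s := by
  set φ : ℤ[X] →+* (ZMod p)[X] := mapRingHom (Int.castRingHom (ZMod p)) with hφ
  have hsurj : Function.Surjective φ := map_surjective _ (ZMod.ringHom_surjective _)
  set Q : Ideal ℤ[X] := P.comap (aeval θ : ℤ[X] →ₐ[ℤ] R) with hQ
  obtain ⟨γ, hγ⟩ := (IsPrincipalIdealRing.principal (Q.map φ)).principal
  obtain ⟨g, hg, hgγ⟩ := (Ideal.mem_map_iff_of_surjective φ hsurj).1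
    (show γ ∈ Q.map φ by rw [hγ]; exact Submodule.mem_span_singleton_self γ)
  refine ⟨g, hg, fun f hf => ?_⟩
  have hφf : φ f ∈ Q.map φ := Ideal.mem_map_of_mem φ hf
  rw [hγ] at hφf
  obtain ⟨c, hc⟩ := Ideal.mem_span_singleton'.1 hφf
  obtain ⟨q, rfl⟩ := hsurj c
  have hz : φ (f - g * q) = 0 := by
    rw [map_sub, map_mul, hgγ, ← hc, mul_comm, sub_self]
  have hd : C (p : ℤ) ∣ f - g * q := by
    rw [C_dvd_iff_dvd_coeff]
    intro i
    have := congrArg (fun h => coeff h i) hz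
    rw [hφ, coe_mapRingHom, coeff_map, coeff_zero, eq_intCast] at this
    exact (ZMod.intCast_zmod_eq_zero_iff_dvd _ p).1 this
  obtain ⟨s, hs⟩ := hd
  exact ⟨q, s, by rw [← hs]; ring⟩

/-- A prime `P` of `R` such that some `x ∈ P` divides every element of `P` after multiplication by
an element outside `P` becomes principal in the localization at `P`. -/
theorem isDiscreteValuationRing_localization_of_forall_dvd_mul {R : Type*} [CommRing R] [IsDomain R]
    [IsNoetherianRing R] (P : Ideal R) [P.IsPrime] (hP : P ≠ ⊥) (x : R) (hx : x ∈ P)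
    (h : ∀ y ∈ P, ∃ u ∉ P, x ∣ y * u) : IsDiscreteValuationRing (Localization.AtPrime P) := by
  have : IsNoetherianRing (Localization.AtPrime P) :=
    IsLocalization.isNoetherianRing P.primeCompl _ inferInstance
  have : IsDomain (Localization.AtPrime P) :=
    IsLocalization.isDomain_localization P.primeCompl_le_nonZeroDivisors
  have hmap := Localization.AtPrime.map_eq_maximalIdeal (I := P)
  have hprin : (IsLocalRing.maximalIdeal (Localization.AtPrime P)).IsPrincipal := by
    refine ⟨algebraMap R _ x, ?_⟩
    rw [← hmap]
    refine le_antisymm (Ideal.map_le_iff_le_comap.2 fun y hy => ?_) ?_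
    · obtain ⟨u, hu, hxu⟩ := h y hy
      have hunit : IsUnit (algebraMap R (Localization.AtPrime P) u) :=
        IsLocalization.map_units _ (⟨u, hu⟩ : P.primeCompl)
      refine Ideal.mem_span_singleton.2 (hunit.dvd_mul_right.1 ?_)
      rw [← map_mul]
      exact map_dvd _ hxu
    · rw [Submodule.span_singleton_le_iff_mem]
      exact Ideal.mem_map_of_mem _ hx
  have hPIR : IsPrincipalIdealRing (Localization.AtPrime P) :=
    ((tfae_of_isNoetherianRing_of_isLocalRing_of_isDomain (Localization.AtPrime P)).out 0 4).2 hprin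
  refine { hPIR with not_a_field' := ?_ }
  rw [← hmap, Ne, Ideal.map_eq_bot_iff_of_injective
    (IsLocalization.injective _ P.primeCompl_le_nonZeroDivisors)]
  exact hP

/-- Let `P` be a prime of `ℤ[θ]` above `p`, where `f(θ) = 0`. If `f'(θ) ∈ P` implies that
`P` contains some `θ - r` with `p ∥ f(r)`, then the localization at `P` is a discrete valuation ring. -/
theorem isDiscreteValuationRing_localization_of_derivative {R : Type*} [CommRing R] [IsDomain R]
    [IsNoetherianRing R] (θ : R) (hθ : Function.Surjective (aeval θ : ℤ[X] →ₐ[ℤ] R)) (f : ℤ[X])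
    (hf : aeval θ f = 0) (P : Ideal R) [hPp : P.IsPrime] (hP : P ≠ ⊥) (p : ℕ) [Fact p.Prime]
    (hp : ∀ n : ℤ, (n : R) ∈ P ↔ (p : ℤ) ∣ n)
    (hder : aeval θ (derivative f) ∈ P →
      ∃ r : ℤ, θ - (r : R) ∈ P ∧ ¬ (p : ℤ) ^ 2 ∣ f.eval r) :
    IsDiscreteValuationRing (Localization.AtPrime P) := by
  have hpP : (p : R) ∈ P := by simpa using (hp p).2 dvd_rfl
  obtain ⟨g, hg, hgen⟩ := exists_generator_of_comap_aeval θ P p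
  obtain ⟨h, k, hfk⟩ := hgen f (by rw [hf]; exact P.zero_mem)
  by_cases hh : aeval θ h ∈ P
  -- Here `f ≡ g ^ 2 q` mod `p`: the double factor puts `f'(θ)` in `P`.
  · obtain ⟨q, s, hqs⟩ := hgen h hh
    obtain ⟨r, hrP, hr⟩ := hder <| by
      rw [hfk, hqs]
      simp only [derivative_mul, derivative_C, map_add, map_mul, aeval_C]
      have e : (algebraMap ℤ R) (p : ℤ) = (p : R) := by simp
      rw [e, map_zero, zero_mul, zero_add, zero_mul, zero_add]
      refine P.add_mem (P.add_mem ?_ ?_) (P.mul_mem_right _ hpP)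
      · exact P.mul_mem_left _ (P.add_mem (P.mul_mem_right _ hg) (P.mul_mem_right _ hpP))
      · exact P.mul_mem_right _ hg
    obtain ⟨w, hw⟩ := X_sub_C_dvd_sub_C_eval (a := r) (p := f)
    have sub_dvd : ∀ t : ℤ[X], θ - (r : R) ∣ aeval θ t - ((t.eval r : ℤ) : R) := fun t => by
      have := map_dvd (aeval θ : ℤ[X] →ₐ[ℤ] R) (X_sub_C_dvd_sub_C_eval (a := r) (p := t))
      simpa using this
    have eval_mem : ∀ t : ℤ[X], aeval θ t ∈ P → (p : ℤ) ∣ t.eval r := fun t ht => by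
      rw [← hp]
      have := P.sub_mem ht (P.mem_of_dvd (sub_dvd t) hrP)
      simpa using this
    obtain ⟨u, hu⟩ := eval_mem f (by rw [hf]; exact P.zero_mem)
    have huP : (u : R) ∉ P := fun hu' => by
      obtain ⟨v, hv⟩ := (hp u).1 hu'
      exact hr ⟨v, by rw [hu, hv]; ring⟩
    -- With `f(r) = p u` and `f(θ) = 0`, `θ - r` divides `p u`, where `u` is a unit at `P`.
    refine isDiscreteValuationRing_localization_of_forall_dvd_mul P hP _ hrP fun y hy => ⟨u, huP, ?_⟩
    obtain ⟨t, rfl⟩ := hθ y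
    obtain ⟨v, hv⟩ := eval_mem t hy
    have h1 : θ - (r : R) ∣ (p : R) * u := by
      have := sub_dvd f
      rw [hf, hu] at this
      simpa using this
    have h2 := sub_dvd t
    rw [hv] at h2
    have : aeval θ t * (u : R) = (aeval θ t - ((p * v : ℤ) : R)) * u + (p * u) * v := by
      push_cast; ring
    rw [this]
    exact dvd_add (h2.mul_right _) (h1.mul_right _)
  -- `f(θ) = 0` reads `g(θ) h(θ) = -p k(θ)`, so `h(θ)` is the multiplier outside `P`.
  · refine isDiscreteValuationRing_localization_of_forall_dvd_mul P hP _ hpP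
      fun y hy => ⟨_, hh, ?_⟩
    obtain ⟨t, rfl⟩ := hθ y
    obtain ⟨q, s, rfl⟩ := hgen t hy
    have h0 : aeval θ g * aeval θ h = -((p : R) * aeval θ k) := by
      rw [hfk] at hf
      simp only [map_add, map_mul, aeval_C] at hf
      rw [eq_neg_iff_add_eq_zero, ← hf]; simp
    refine ⟨- aeval θ k * aeval θ q + aeval θ s * aeval θ h, ?_⟩
    simp only [map_add, map_mul, aeval_C]
    simp only [eq_intCast, Int.cast_natCast]
    linear_combination aeval θ q * h0

theorem derivative_trinomialF {m : ℕ} (hm : 2 ≤ m) (A B : ℤ) :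
    derivative (trinomialF m A B) =
      X ^ (m - 2) * (C (m : ℤ) * X + C (((m : ℤ) - 1) * A)) := by
  obtain ⟨n, rfl⟩ := Nat.exists_eq_add_of_le' hm
  simp only [trinomialF, derivative_add, derivative_X_pow, derivative_C, derivative_mul]
  simp only [show n + 2 - 1 = n + 1 by omega, show n + 2 - 2 = n by omega, Nat.add_sub_cancel]
  push_cast
  simp only [map_add, map_mul, map_sub, map_one, map_natCast]
  simp
  ring

/-- Modulo `N`, at a root `r` of `m X + (m - 1) A`, the value of the trinomial is `D` up to `m ^ m`. -/
theorem dvd_trinomialD_of_dvd_eval {m : ℕ} (hm : 2 ≤ m) {A B N r : ℤ}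
    (hr : N ∣ m * r + (m - 1) * A) (hF : N ∣ (trinomialF m A B).eval r) :
    N ∣ trinomialD m A B := by
  obtain ⟨n, rfl⟩ := Nat.exists_eq_add_of_le' hm
  simp only [trinomialF, trinomialD, eval_add, eval_mul, eval_pow, eval_X, eval_C,
    show n + 2 - 1 = n + 1 by omega] at *
  set M : ℤ := ((n + 2 : ℕ) : ℤ)
  have h1 : M * r ≡ -((M - 1) * A) [ZMOD N] :=
    (Int.modEq_iff_dvd.2 (by convert hr using 1; ring)).symm
  have h2 : M ^ (n + 2) * (r ^ (n + 2) + A * r ^ (n + 1) + B) ≡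
      M ^ (n + 2) * B - (-1) ^ (n + 2) * (M - 1) ^ (n + 1) * A ^ (n + 2) [ZMOD N] := by
    have e1 : M ^ (n + 2) * (r ^ (n + 2) + A * r ^ (n + 1) + B) =
      (M * r) ^ (n + 1) * (M * r + M * A) + M ^ (n + 2) * B := by ring
    have e2 : M ^ (n + 2) * B - (-1) ^ (n + 2) * (M - 1) ^ (n + 1) * A ^ (n + 2) =
      (-((M - 1) * A)) ^ (n + 1) * (-((M - 1) * A) + M * A) + M ^ (n + 2) * B := by
      rw [neg_pow ((M - 1) * A), mul_pow]; ring
    rw [e1, e2]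
    gcongr
  exact (Int.ModEq.dvd_iff h2).1 (hF.mul_left _)

theorem isIntegrallyClosed_of_trinomialF {R : Type*} [CommRing R] [IsDomain R] {m : ℕ}
    (hm : 2 ≤ m) {A B : ℤ} (hB : Squarefree B) (hD : Squarefree (trinomialD m A B)) (θ : R)
    (hθ : Function.Surjective (aeval θ : ℤ[X] →ₐ[ℤ] R)) (h0 : aeval θ (trinomialF m A B) = 0)
    [Algebra.IsIntegral ℤ R] : IsIntegrallyClosed R := by
  have hN : IsNoetherianRing R :=
    isNoetherianRing_of_surjective ℤ[X] R (aeval θ : ℤ[X] →ₐ[ℤ] R).toRingHom hθ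
  have : IsDedekindDomainDvr R := by
    refine { hN with is_dvr_at_nonzero_prime := fun P hP hPp => ?_ }
    have hc0 := Ideal.IsIntegral.comap_ne_bot (R := ℤ) hP
    have hcp : (P.comap (algebraMap ℤ R)).IsPrime := inferInstance
    obtain ⟨c, hc⟩ := (IsPrincipalIdealRing.principal (P.comap (algebraMap ℤ R))).principal
    change _ = Ideal.span {c} at hc
    have hcne : c ≠ 0 := by rintro rfl; exact hc0 (by rw [hc, Ideal.span_singleton_eq_bot])
    have hcprime : Prime c := (Ideal.span_singleton_prime hcne).1 (hc ▸ hcp)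
    have hpn : Fact c.natAbs.Prime := ⟨Int.prime_iff_natAbs_prime.1 hcprime⟩
    set p := c.natAbs
    have hp : ∀ n : ℤ, (n : R) ∈ P ↔ (p : ℤ) ∣ n := fun n => by
      rw [Int.natAbs_dvd, ← Ideal.mem_span_singleton, ← hc, Ideal.mem_comap, eq_intCast]
    have hpprime : Prime (p : ℤ) := Nat.prime_iff_prime_int.1 hpn.out
    have not_sq : ∀ {n : ℤ}, Squarefree n → ¬ (p : ℤ) ^ 2 ∣ n := fun hn hd =>
      hpprime.not_isUnit (hn _ (by rwa [← sq]))
    refine isDiscreteValuationRing_localization_of_derivative θ hθ _ h0 P hP p hp fun hder => ?_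
    have key : θ ∈ P ∨ (m : R) * θ + ((m : R) - 1) * A ∈ P := by
      rw [derivative_trinomialF hm, map_mul, map_pow, aeval_X] at hder
      refine (hPp.mem_or_mem hder).imp (hPp.mem_of_pow_mem _) fun h => ?_
      simpa using h
    rcases key with h | h
    · refine ⟨0, by simpa using h, ?_⟩
      have : (trinomialF m A B).eval 0 = B := by
        simp [trinomialF, show m ≠ 0 by omega, show m - 1 ≠ 0 by omega]
      rw [this]
      exact not_sq hB
    · by_cases hpm : (p : ℤ) ∣ m
      · exfalso
        -- As `p` cannot divide both `m` and `m - 1`, it divides `A`; then `p ^ 2` divides both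
        -- terms of `D` because `m ≥ 2`.
        have hA : (p : ℤ) ∣ ((m : ℤ) - 1) * A := by
          rw [← hp]
          have := P.sub_mem h (P.mul_mem_right θ ((hp m).2 hpm))
          simpa using this
        have hA' : (p : ℤ) ∣ A := (hpprime.dvd_or_dvd hA).resolve_left fun h1 =>
          hpprime.not_isUnit (isUnit_of_dvd_one (by simpa using dvd_sub hpm h1))
        have pow_dvd : ∀ {n : ℤ}, (p : ℤ) ∣ n → (p : ℤ) ^ 2 ∣ n ^ m := fun hn =>
          (pow_dvd_pow _ hm).trans (pow_dvd_pow_of_dvd hn m)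
        exact not_sq hD (dvd_sub ((pow_dvd hpm).mul_right _) ((pow_dvd hA').mul_left _))
      -- Inverting `m` modulo `p ^ 2`, not just `p`, lets `p ^ 2 ∣ F(r)` force `p ^ 2 ∣ D`.
      · have hcop : IsCoprime (m : ℤ) ((p : ℤ) ^ 2) :=
          ((hpprime.coprime_iff_not_dvd).2 hpm).symm.pow_right
        obtain ⟨a, b, hab⟩ := hcop
        set r : ℤ := -(a * ((m - 1) * A)) with hrdef
        have hr : (p : ℤ) ^ 2 ∣ m * r + (m - 1) * A :=
          ⟨b * ((m - 1) * A), by rw [hrdef]; linear_combination -((m - 1) * A) * hab⟩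
        refine ⟨r, ?_, fun hF => not_sq hD (dvd_trinomialD_of_dvd_eval hm hr hF)⟩
        have h1 : (((m * r + (m - 1) * A : ℤ)) : R) ∈ P :=
          (hp _).2 ((dvd_pow_self _ two_ne_zero).trans hr)
        have h2 : (m : R) * (θ - r) ∈ P := by
          have := P.sub_mem h h1
          push_cast at this
          convert this using 1
          ring
        refine (hPp.mem_or_mem h2).resolve_left fun h3 => hpm ((hp m).1 (by simpa using h3))
  infer_instance

/-- If `ℤ[x]` is integrally closed, then it contains every element of `ℚ(x)` integral over `ℤ`. -/
theorem integralClosure_eq_adjoin_gen {θ : ℂ} (hθ : IsIntegral ℤ θ)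
    (hic : IsIntegrallyClosed
      (Algebra.adjoin ℤ {IntermediateField.AdjoinSimple.gen ℚ θ})) :
    integralClosure ℤ (IntermediateField.adjoin ℚ {θ}) =
      Algebra.adjoin ℤ {IntermediateField.AdjoinSimple.gen ℚ θ} := by
  set K := IntermediateField.adjoin ℚ {θ}
  set x : K := IntermediateField.AdjoinSimple.gen ℚ θ with hx
  set S := Algebra.adjoin ℤ {x} with hS
  have hxint : IsIntegral ℤ x :=
    (isIntegral_algebraMap_iff (algebraMap K ℂ).injective).1
      (by rwa [hx, IntermediateField.AdjoinSimple.algebraMap_gen])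
  -- Clear denominators in a rational polynomial expression for `z`.
  have hfrac : IsFractionRing S K := by
    refine IsFractionRing.of_field S K fun z => ?_
    obtain ⟨q, hq⟩ : ∃ q : ℚ[X], z = aeval x q :=
      (IntermediateField.adjoin.powerBasis (hθ.tower_top (A := ℚ))).exists_eq_aeval' z
    obtain ⟨b, hb, hbq⟩ := IsLocalization.integerNormalization_spec (nonZeroDivisors ℤ) q
    set f := IsLocalization.integerNormalization (nonZeroDivisors ℤ) q
    have hbz : aeval x f = (b : K) * z := by
      rw [← aeval_map_algebraMap ℚ x f, hbq, map_zsmul, ← hq, zsmul_eq_mul]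
    have hb0 : (b : K) ≠ 0 := Int.cast_ne_zero.2 (nonZeroDivisors.ne_zero hb)
    refine ⟨⟨aeval x f, aeval_mem_adjoin_singleton ℤ x⟩, (b : S), ?_⟩
    rw [map_intCast, eq_div_iff hb0, mul_comm, ← hbz]
    rfl
  refine le_antisymm (fun z hz => ?_) (Algebra.adjoin_le (Set.singleton_subset_iff.2 hxint))
  obtain ⟨y, rfl⟩ := (IsIntegrallyClosed.isIntegral_iff (R := S) (K := K)).1
    (IsIntegral.tower_top (A := S) (show IsIntegral ℤ z from hz))
  exact y.2

theorem mainTheorem3 (m : ℕ) (hm : 2 ≤ m) (A B : ℤ)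
    (hB : Squarefree B) (hB2 : 2 ≤ |B|)
    (hD : Squarefree (trinomialD m A B))
    (hirr : Irreducible ((trinomialF m A B).map (Int.castRingHom ℚ))) :
    IsMonogenicPoly (trinomialF m A B) := by
  refine ⟨hirr, fun θ hθ => ?_⟩
  have hmonic : (trinomialF m A B).Monic := by
    unfold trinomialF
    rw [add_assoc]
    refine monic_X_pow_add ?_
    refine (degree_add_le _ _).trans_lt (max_lt ?_ ?_)
    · refine (degree_C_mul_X_pow_le _ _).trans_lt ?_
      exact_mod_cast (by omega : m - 1 < m)
    · refine degree_C_le.trans_lt ?_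
      exact_mod_cast (by omega : 0 < m)
  have hint : IsIntegral ℤ θ := ⟨_, hmonic, hθ⟩
  refine integralClosure_eq_adjoin_gen hint ?_
  set x := IntermediateField.AdjoinSimple.gen ℚ θ with hx
  have hxint : IsIntegral ℤ x :=
    (isIntegral_algebraMap_iff (algebraMap (IntermediateField.adjoin ℚ {θ}) ℂ).injective).1
      (by rwa [hx, IntermediateField.AdjoinSimple.algebraMap_gen])
  have hx0 : aeval x (trinomialF m A B) = 0 := by
    apply (algebraMap (IntermediateField.adjoin ℚ {θ}) ℂ).injective
    rw [← aeval_algebraMap_apply, hx, IntermediateField.AdjoinSimple.algebraMap_gen, hθ, map_zero]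
  set S := Algebra.adjoin ℤ {x}
  set y : S := ⟨x, Algebra.self_mem_adjoin_singleton ℤ x⟩ with hy
  have hval : ∀ f : ℤ[X], ((aeval y f : S) : IntermediateField.adjoin ℚ {θ}) = aeval x f :=
    fun f => (aeval_algHom_apply S.val y f).symm
  have : Algebra.IsIntegral ℤ S := ⟨fun z =>
    (isIntegral_algHom_iff S.val Subtype.val_injective).1
      (Algebra.adjoin_le (S := integralClosure ℤ _) (Set.singleton_subset_iff.2 hxint) z.2)⟩
  refine isIntegrallyClosed_of_trinomialF hm hB hD y (fun z => ?_) ?_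
  · obtain ⟨f, hf⟩ := (Algebra.adjoin_singleton_eq_range_aeval ℤ x ▸ z.2 :
      (z : IntermediateField.adjoin ℚ {θ}) ∈ (aeval x : ℤ[X] →ₐ[ℤ] _).range)
    exact ⟨f, Subtype.ext ((hval f).trans hf)⟩
  · exact Subtype.ext ((hval _).trans hx0)
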